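/- Let $S$ and $A$ be finite sets and let $\mathcal M=(S,A,P,\mu_0,\gamma)$ be a reward-free discounted MDP: $P(\cdot\mid s,a)$ is a probability distribution on $S$ for each $(s,a)\in S\times A$, $\mu_0$ is a probability distribution on $S$, and $\gamma\in[0,1)$. Let $\Phi$ be the polytope of normalized discounted occupancy measures, i.e. of all $d\in\mathbb R^{S\times A}$ with $d\ge 0$ and $$\sum_{a\in A}d(s',a)-\gamma\sum_{(s,a)\in S\times A}P(s'\mid s,a)\,d(s,a)=(1-\gamma)\mu_0(s')\qquad\text{for all } s'\in S .$$ For a reward $r\in\mathbb R^{S\times A}$ put $\operatorname{subopt}(r,d)=\max_{d'\in\Phi}r^\top(d'-d)$ and $\Phi^\star(r)=\operatorname{argmax}_{d\in\Phi}r^\top d$. Let $d_e\in\Phi$, let $\Delta(S\times A)$ be the probability simplex in $\mathbb R^{S\times A}$, and let $$\mathcal R(d_e)=\{r\in\Delta(S\times A)\;:\;\operatorname{subopt}(r,d_e)\le 0\}$$ be the set of rewards in the simplex under which $d_e$ is optimal. Let $F_e$ be the minimal face of $\Phi$ containing $d_e$, i.e. the intersection of all faces of $\Phi$ containing $d_e$.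 Then for every $r\in\mathcal R(d_e)$, the set $\Phi^\star(r)$ is an exposed face of $\Phi$ containing $d_e$. Moreover, if $r$ lies in the relative interior of $\mathcal R(d_e)$, then $\Phi^\star(r)=F_e$. -/

import Mathlib

/-- A finite, discounted, reward-free MDP with state space `S` and action space `A`:
transition kernel `P`, initial state distribution `μ₀`, discount factor `γ ∈ [0, 1)`. -/
structure RewardFreeMDP (S A : Type*) [Fintype S] where
  P : S → A → S → ℝ
  P_mem : ∀ s a, P s a ∈ stdSimplex ℝ S
  μ₀ : S → ℝ
  μ₀_mem : μ₀ ∈ stdSimplex ℝ S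
  γ : ℝ
  γ_nonneg : 0 ≤ γ
  γ_lt_one : γ < 1

namespace RewardFreeMDP

variable {S A : Type*} [Fintype S] [Fintype A]

open Classical in
/-- The Bellman flow matrix `M`, with entries `M s' (s, a) = 1{s' = s} - γ P(s' ∣ s, a)`. -/
noncomputable def flowMatrix (𝓜 : RewardFreeMDP S A) : Matrix S (S × A) ℝ :=
  Matrix.of fun s' z => (if s' = z.1 then 1 else 0) - 𝓜.γ * 𝓜.P z.1 z.2 s'

/-- The set `Φ` of (normalized, discounted) occupancy measures: `d ≥ 0` with `M d = (1 - γ) μ₀`. -/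
def occupancySet (𝓜 : RewardFreeMDP S A) : Set (S × A → ℝ) :=
  {d | (∀ z, 0 ≤ d z) ∧ 𝓜.flowMatrix.mulVec d = (1 - 𝓜.γ) • 𝓜.μ₀}

/-- The suboptimality `max_{d' ∈ Φ} rᵀ (d' - d)` of the occupancy `d` under the reward `r`. -/
noncomputable def subopt (𝓜 : RewardFreeMDP S A) (r d : S × A → ℝ) : ℝ :=
  sSup ((fun d' => r ⬝ᵥ (d' - d)) '' 𝓜.occupancySet)

/-- The rewards in the probability simplex under which `d` is at most `ε`-suboptimal. -/
def feasibleRewards (𝓜 : RewardFreeMDP S A) (d : S × A → ℝ) (ε : ℝ) : Set (S × A → ℝ) :=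
  {r | r ∈ stdSimplex ℝ (S × A) ∧ 𝓜.subopt r d ≤ ε}

/-- `ℛ(d)`: the rewards in the probability simplex under which `d` is optimal
(suboptimality level `0`). -/
def optimalRewards (𝓜 : RewardFreeMDP S A) (d : S × A → ℝ) : Set (S × A → ℝ) :=
  𝓜.feasibleRewards d 0

/-- `Φ⋆(r) = argmax_{d ∈ Φ} rᵀ d`. -/
def optimalOccupancies (𝓜 : RewardFreeMDP S A) (r : S × A → ℝ) : Set (S × A → ℝ) :=
  {d | d ∈ 𝓜.occupancySet ∧ ∀ d' ∈ 𝓜.occupancySet, r ⬝ᵥ d' ≤ r ⬝ᵥ d}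

end RewardFreeMDP

/-- `F` is a face of the convex set `C`: a convex subset of `C` that contains both endpoints of
every segment of `C` having a relative interior point in `F`. -/
def IsConvexFace {E : Type*} [AddCommGroup E] [Module ℝ E] (C F : Set E) : Prop :=
  IsExtreme ℝ C F ∧ Convex ℝ F

/-- The minimal face of `C` containing `x`: the intersection of all faces of `C` containing `x`. -/
def minimalFace {E : Type*} [AddCommGroup E] [Module ℝ E] (C : Set E) (x : E) : Set E :=
  ⋂₀ {F | IsConvexFace C F ∧ x ∈ F}

/-- For a point `x` of a convex set `C`, `minimalFace C x` is itself a face of `C` containing `x`,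
and it is the smallest one. -/
theorem minimalFace_isLeast {E : Type*} [AddCommGroup E] [Module ℝ E] {C : Set E}
    (hC : Convex ℝ C) {x : E} (hx : x ∈ C) :
    IsLeast {F | IsConvexFace C F ∧ x ∈ F} (minimalFace C x) := by
  refine ⟨⟨⟨isExtreme_sInter ⟨C, ⟨IsExtreme.refl ℝ C, hC⟩, hx⟩ fun F hF => hF.1.1,
    convex_sInter fun F hF => hF.1.2⟩, fun F hF => hF.2⟩, fun F hF => Set.sInter_subset_of_mem hF⟩

/-! `Φ` is cut out of an affine subspace by `d ≥ 0`, so any `d ∈ Φ` supported in the support of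
`d_e` lies in `F_e`. Since `Φ⋆(r)` is a face through `d_e`, it contains `F_e`. Conversely, suppose
some `d ∈ Φ⋆(r)` charges a pair `z` with `d_e z = 0`. The uniform reward `r₁` off `z` lies in
`ℛ(d_e)` and strictly prefers `d_e` to `d`. Pushing `r` slightly away from `r₁` stays in `ℛ(d_e)`
but makes `d` strictly better than `d_e`, a contradiction. -/

/-- A point of the relative interior of `R` can be pushed slightly beyond itself, away from any
other point of `R`, without leaving `R`. -/
theorem exists_add_smul_sub_mem_of_mem_intrinsicInterior {E : Type*} [AddCommGroup E] [Module ℝ E]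
    [TopologicalSpace E] [IsTopologicalAddGroup E] [ContinuousSMul ℝ E] {R : Set E} {x y : E}
    (hx : x ∈ intrinsicInterior ℝ R) (hy : y ∈ R) :
    ∃ ε : ℝ, 0 < ε ∧ x + ε • (x - y) ∈ R := by
  obtain ⟨x', hx', rfl⟩ := mem_intrinsicInterior.1 hx
  have hmem : ∀ t : ℝ, (x' : E) + t • ((x' : E) - y) ∈ affineSpan ℝ R := fun t => by
    have h := AffineMap.lineMap_mem (-t) x'.2 (subset_affineSpan ℝ R hy)
    convert h using 1
    rw [AffineMap.lineMap_apply_module']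
    module
  let f : ℝ → affineSpan ℝ R := fun t => ⟨(x' : E) + t • ((x' : E) - y), hmem t⟩
  have hf : Continuous f := Continuous.subtype_mk (by fun_prop) _
  have hf0 : f 0 = x' := Subtype.ext (by simp [f])
  have hev : ∀ᶠ t in nhds (0 : ℝ), f t ∈ ((↑) ⁻¹' R : Set (affineSpan ℝ R)) :=
    hf.continuousAt.eventually (by rw [hf0]; exact mem_interior_iff_mem_nhds.1 hx')
  obtain ⟨ε, hε, hpos⟩ :=
    ((hev.filter_mono (nhdsWithin_le_nhds (s := Set.Ioi 0))).and self_mem_nhdsWithin).exists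
  exact ⟨ε, hpos, hε⟩

namespace RewardFreeMDP

theorem sum_flowMatrix {S A : Type*} [Fintype S] (𝓜 : RewardFreeMDP S A) (z : S × A) :
    ∑ s, 𝓜.flowMatrix s z = 1 - 𝓜.γ := by
  classical
  simp [flowMatrix, Finset.sum_sub_distrib, ← Finset.mul_sum, (𝓜.P_mem z.1 z.2).2]

variable {S A : Type*} [Fintype S] [Fintype A]

/-- Summing the flow equations over states leaves `(1 - γ) ∑ d = 1 - γ`, and `γ < 1`. -/
theorem sum_eq_one_of_mem_occupancySet (𝓜 : RewardFreeMDP S A) {d : S × A → ℝ}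
    (hd : d ∈ 𝓜.occupancySet) : ∑ z, d z = 1 := by
  have h : ∑ s, 𝓜.flowMatrix.mulVec d s = ∑ s, ((1 - 𝓜.γ) • 𝓜.μ₀) s := by rw [hd.2]
  simp only [Matrix.mulVec, dotProduct, Pi.smul_apply, smul_eq_mul, ← Finset.mul_sum,
    𝓜.μ₀_mem.2] at h
  rw [Finset.sum_comm] at h
  simp only [← Finset.sum_mul, sum_flowMatrix, ← Finset.mul_sum] at h
  exact mul_left_cancel₀ (sub_pos.2 𝓜.γ_lt_one).ne' h

theorem le_one_of_mem_occupancySet (𝓜 : RewardFreeMDP S A) {d : S × A → ℝ}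
    (hd : d ∈ 𝓜.occupancySet) (z : S × A) : d z ≤ 1 :=
  𝓜.sum_eq_one_of_mem_occupancySet hd ▸
    Finset.single_le_sum (fun i _ => hd.1 i) (Finset.mem_univ z)

/-- Ensures that the `sSup` in `subopt` is a genuine upper bound, not the default value `0`. -/
theorem bddAbove_dotProduct_sub (𝓜 : RewardFreeMDP S A) (r d : S × A → ℝ) :
    BddAbove ((fun d' => r ⬝ᵥ (d' - d)) '' 𝓜.occupancySet) := by
  refine ⟨∑ z, |r z| - r ⬝ᵥ d, ?_⟩
  rintro _ ⟨d', hd', rfl⟩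
  simp only [dotProduct_sub]
  refine sub_le_sub_right (Finset.sum_le_sum fun z _ => ?_) _
  calc r z * d' z ≤ |r z| * d' z := mul_le_mul_of_nonneg_right (le_abs_self _) (hd'.1 z)
    _ ≤ |r z| := mul_le_of_le_one_right (abs_nonneg _) (𝓜.le_one_of_mem_occupancySet hd' z)

theorem subopt_nonpos_iff (𝓜 : RewardFreeMDP S A) {r d : S × A → ℝ} :
    𝓜.subopt r d ≤ 0 ↔ ∀ d' ∈ 𝓜.occupancySet, r ⬝ᵥ d' ≤ r ⬝ᵥ d := by
  constructor
  · intro h d' hd'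
    have := (le_csSup (𝓜.bddAbove_dotProduct_sub r d) ⟨d', hd', rfl⟩).trans h
    simpa [dotProduct_sub] using this
  · intro h
    refine Real.sSup_nonpos ?_
    rintro _ ⟨d', hd', rfl⟩
    simpa [dotProduct_sub] using h d' hd'

theorem isExposed_optimalOccupancies (𝓜 : RewardFreeMDP S A) (r : S × A → ℝ) :
    IsExposed ℝ 𝓜.occupancySet (𝓜.optimalOccupancies r) := fun _ =>
  ⟨LinearMap.toContinuousLinearMap (dotProductBilin ℝ ℝ r), rfl⟩

theorem convex_occupancySet (𝓜 : RewardFreeMDP S A) : Convex ℝ 𝓜.occupancySet := by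
  intro x hx y hy a b ha hb hab
  refine ⟨fun z => add_nonneg (mul_nonneg ha (hx.1 z)) (mul_nonneg hb (hy.1 z)), ?_⟩
  rw [Matrix.mulVec_add, Matrix.mulVec_smul, Matrix.mulVec_smul, hx.2, hy.2, ← add_smul, hab,
    one_smul]

/-- An occupancy measure supported in the support of `d₀` lies in every face through `d₀`. -/
theorem mem_minimalFace_of_support_subset (𝓜 : RewardFreeMDP S A) {d₀ d : S × A → ℝ}
    (hd₀ : d₀ ∈ 𝓜.occupancySet) (hd : d ∈ 𝓜.occupancySet) (h : ∀ z, d₀ z = 0 → d z = 0) :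
    d ∈ minimalFace 𝓜.occupancySet d₀ := by
  -- Coordinates where `d₀` vanishes stay zero; the finitely many positive ones stay positive for
  -- small `ε`.
  have hev : ∀ᶠ ε in nhdsWithin (0 : ℝ) (Set.Ioi 0), ∀ z, 0 ≤ d₀ z + ε * (d₀ z - d z) := by
    refine Filter.eventually_all.2 fun z => ?_
    rcases (hd₀.1 z).eq_or_lt with hz | hz
    · simp [← hz, h z hz.symm]
    · refine Filter.Eventually.filter_mono nhdsWithin_le_nhds ?_
      have hc : Continuous fun ε : ℝ => d₀ z + ε * (d₀ z - d z) := by fun_prop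
      exact (hc.continuousAt.eventually (lt_mem_nhds (by simpa using hz))).mono fun _ => le_of_lt
  obtain ⟨ε, hε, hpos⟩ := (hev.and self_mem_nhdsWithin).exists
  have hpos : 0 < ε := hpos
  have hmem : d₀ + ε • (d₀ - d) ∈ 𝓜.occupancySet := by
    refine ⟨hε, ?_⟩
    rw [Matrix.mulVec_add, Matrix.mulVec_smul, Matrix.mulVec_sub, hd₀.2, hd.2, sub_self,
      smul_zero, add_zero]
  rintro F ⟨hF, hF₀⟩
  refine hF.1.left_mem_of_mem_openSegment hd hmem hF₀
    -- These weights recover `d₀` from `d` and `d₀ + ε • (d₀ - d)`.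
    ⟨ε / (1 + ε), 1 / (1 + ε), by positivity, by positivity, by field_simp; ring, ?_⟩
  ext z
  simp only [Pi.add_apply, Pi.smul_apply, Pi.sub_apply, smul_eq_mul]
  field_simp
  ring

/-- If `d₀` vanishes at `z`, then `d₀` is optimal for the uniform reward on the complement of `z`,
and strictly better than every occupancy measure charging `z`. -/
theorem exists_mem_optimalRewards_dotProduct_lt (𝓜 : RewardFreeMDP S A) {d₀ d : S × A → ℝ}
    (hd₀ : d₀ ∈ 𝓜.occupancySet) (hd : d ∈ 𝓜.occupancySet) {z : S × A} (hz₀ : d₀ z = 0)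
    (hz : 0 < d z) : ∃ r ∈ 𝓜.optimalRewards d₀, r ⬝ᵥ d < r ⬝ᵥ d₀ := by
  classical
  set n : ℝ := ((Finset.univ.erase z).card : ℝ) with hn
  -- If `z` were the only pair, `d₀` would have total mass `0`.
  have hn0 : 0 < n := by
    rw [hn, Nat.cast_pos, Finset.card_pos]
    by_contra hne
    have h1 := 𝓜.sum_eq_one_of_mem_occupancySet hd₀
    rw [← Finset.add_sum_erase _ _ (Finset.mem_univ z), Finset.not_nonempty_iff_eq_empty.1 hne,
      hz₀] at h1
    simp at h1
  let r : S × A → ℝ := fun w => if w = z then 0 else n⁻¹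
  -- Total mass one makes the return depend on `d' z` alone.
  have hr : ∀ d' ∈ 𝓜.occupancySet, r ⬝ᵥ d' = n⁻¹ * (1 - d' z) := by
    intro d' hd'
    rw [← 𝓜.sum_eq_one_of_mem_occupancySet hd', ← Finset.add_sum_erase _ _ (Finset.mem_univ z),
      add_sub_cancel_left, Finset.mul_sum, dotProduct,
      ← Finset.add_sum_erase _ _ (Finset.mem_univ z)]
    simp only [r, if_true, zero_mul, zero_add]
    exact Finset.sum_congr rfl fun w hw => by rw [if_neg (Finset.ne_of_mem_erase hw)]
  refine ⟨r, ⟨⟨fun w => ?_, ?_⟩, 𝓜.subopt_nonpos_iff.2 fun d' hd' => ?_⟩, ?_⟩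
  · change 0 ≤ if w = z then 0 else n⁻¹
    split_ifs
    exacts [le_rfl, (inv_pos.2 hn0).le]
  · rw [← Finset.add_sum_erase _ _ (Finset.mem_univ z),
      Finset.sum_congr rfl fun w hw => if_neg (Finset.ne_of_mem_erase hw), Finset.sum_const,
      nsmul_eq_mul, ← hn, mul_inv_cancel₀ hn0.ne']
    simp [r]
  · rw [hr d' hd', hr d₀ hd₀, hz₀]
    exact mul_le_mul_of_nonneg_left (by linarith [hd'.1 z]) (inv_pos.2 hn0).le
  · rw [hr d hd, hr d₀ hd₀, hz₀]
    exact mul_lt_mul_of_pos_left (by linarith) (inv_pos.2 hn0)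

end RewardFreeMDP

theorem mainTheorem8 {S A : Type*} [Fintype S] [Fintype A] (𝓜 : RewardFreeMDP S A)
    (d_e : S × A → ℝ) (hd_e : d_e ∈ 𝓜.occupancySet) :
    (∀ r ∈ 𝓜.optimalRewards d_e,
      IsExposed ℝ 𝓜.occupancySet (𝓜.optimalOccupancies r) ∧ d_e ∈ 𝓜.optimalOccupancies r) ∧
    (∀ r ∈ intrinsicInterior ℝ (𝓜.optimalRewards d_e),
      𝓜.optimalOccupancies r = minimalFace 𝓜.occupancySet d_e) := by
  have hexp : ∀ r ∈ 𝓜.optimalRewards d_e,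
      IsExposed ℝ 𝓜.occupancySet (𝓜.optimalOccupancies r) ∧ d_e ∈ 𝓜.optimalOccupancies r :=
    fun r hr => ⟨𝓜.isExposed_optimalOccupancies r, hd_e, 𝓜.subopt_nonpos_iff.1 hr.2⟩
  refine ⟨hexp, fun r hr => Set.Subset.antisymm (fun d hd => ?_) ?_⟩
  · refine 𝓜.mem_minimalFace_of_support_subset hd_e hd.1 fun z hz => ?_
    by_contra hne
    obtain ⟨r₁, hr₁, hlt⟩ := 𝓜.exists_mem_optimalRewards_dotProduct_lt hd_e hd.1 hz
      ((hd.1.1 z).lt_of_ne' hne)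
    obtain ⟨ε, hε, hmem⟩ := exists_add_smul_sub_mem_of_mem_intrinsicInterior hr hr₁
    have h₁ := 𝓜.subopt_nonpos_iff.1 hmem.2 d hd.1
    have h₂ := hd.2 d_e hd_e
    simp only [add_dotProduct, smul_dotProduct, sub_dotProduct, smul_eq_mul] at h₁
    nlinarith [mul_pos hε (sub_pos.2 hlt), mul_nonneg hε.le (sub_nonneg.2 h₂)]
  · obtain ⟨h₁, h₂⟩ := hexp r (intrinsicInterior_subset hr)
    exact Set.sInter_subset_of_mem ⟨⟨h₁.isExtreme, h₁.convex 𝓜.convex_occupancySet⟩, h₂⟩
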